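/- **Theorem (Identifiability under a fixed temporal causal model).** Let $\mathcal Z=I_1\times\dots\times I_n\subseteq\mathbb R^n$ be a product of open intervals (for instance $\mathcal Z=\mathbb R^n$), let $(\mathbf z_t)$ be a stochastic process with values in $\mathcal Z$, and let $\mathbf x_t=\mathbf g(\mathbf z_t)$, where $\mathbf g$ is an invertible map of $\mathcal Z$ onto the observation space $\mathcal X=\mathbf g(\mathcal Z)$. Let $\hat{\mathbf g}:\mathcal X\to\mathbb R^n$ be injective (invertible onto its image) and $\hat{\mathbf z}_t=\hat{\mathbf g}(\mathbf x_t)$. Assume that $\hat{\mathbf g}\circ\mathbf g$ is a $C^2$ diffeomorphism of $\mathcal Z$ onto its image, i.e. $C^2$ and injective with everywhere non-singular Jacobian matrix. Fix $t$. Assume that the components of $\mathbf z_t$ are mutually independent conditionally on $\mathbf z_{t-1}$, that the components of $\hat{\mathbf z}_t$ are mutually independent conditionally on $\hat{\mathbf z}_{t-1}$, and that every measurable subset of $\mathcal Z$ of positive Lebesgue measure has positive probability under the law of $\mathbf z_{t-1}$ (for instance, $\mathbf z_{t-1}$ has a positive density on $\mathcal Z$). For each $k$ let the conditional law of $z_{k,t}$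 given $\mathbf z_{t-1}$ have a density $p(z_{k,t}\mid\mathbf z_{t-1})$ that is strictly positive for $z_{k,t}\in I_k$, $\mathbf z_{t-1}\in\mathcal Z$, and put $\eta_{kt}=\log p(z_{k,t}\mid \mathbf z_{t-1})$. Assume that $\eta_{kt}$ is twice differentiable in $z_{k,t}$ and that $\partial\eta_{kt}/\partial z_{k,t}$ and $\partial^2\eta_{kt}/\partial z_{k,t}^2$ are differentiable in each $z_{l,t-1}$, $l=1,\dots,n$. Let $$\mathbf v_{kt}=\Big(\frac{\partial^2\eta_{kt}}{\partial z_{k,t}\,\partial z_{l,t-1}}\Big)_{l=1}^n,\qquad \mathring{\mathbf v}_{kt}=\Big(\frac{\partial^3\eta_{kt}}{\partial z_{k,t}^2\,\partial z_{l,t-1}}\Big)_{l=1}^n ,$$ where the derivatives in $z_{k,t}$ are taken first. If for each value of $\mathbf z_t\in\mathcal Z$ the $2n$ vector functions $\mathbf v_{1t},\mathring{\mathbf v}_{1t},\dots,\mathbf v_{nt},\mathring{\mathbf v}_{nt}$ of $\mathbf z_{t-1}\in\mathcal Z$ are linearly independent over $\mathbb R$, then the latent vector is an invertible, component-wise transformation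 of a permutation of the estimated one: there are a permutation $\pi$ of $\{1,\dots,n\}$ and bijections $T_k$ from the set of values of the $\pi(k)$-th component of $\hat{\mathbf g}\circ\mathbf g$ on $\mathcal Z$ onto $I_k$ such that $z_k=T_k\big(\hat g_{\pi(k)}(\mathbf g(\mathbf z))\big)$ for all $\mathbf z\in\mathcal Z$ and all $k$. In particular $z_{k,\tau}=T_k(\hat z_{\pi(k),\tau})$ for all times $\tau$ and all $k$. -/

import Mathlib

open MeasureTheory ProbabilityTheory

noncomputable section

/-- The product `∏ₖ I k` of coordinate ranges, as a subset of `ℝⁿ`. For `I k = Set.univ` it is all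
of `ℝⁿ`. -/
def latentSpace {n : ℕ} (I : Fin n → Set ℝ) : Set (Fin n → ℝ) :=
  Set.univ.pi I

/-- The components of the random vector `Y` are mutually independent conditionally on the random
vector `S` (that is, on the σ-algebra generated by `S`). -/
def CondIndepComponents {Ω : Type*} [MeasurableSpace Ω] [StandardBorelSpace Ω] (P : Measure Ω)
    [IsFiniteMeasure P] {n : ℕ} (Y S : Ω → Fin n → ℝ) (hS : Measurable S) : Prop :=
  iCondIndepFun (MeasurableSpace.comap S inferInstance) hS.comap_le (fun k ω => Y ω k) P

/-- `y ↦ p y s` is a density on `J`, with respect to Lebesgue measure, of the conditional law of the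
real random variable `Y` given `S = s`, for almost every value `s` of `S`. -/
def IsCondDensityOn {Ω : Type*} [MeasurableSpace Ω] (P : Measure Ω) [IsFiniteMeasure P] {n : ℕ}
    (Y : Ω → ℝ) (S : Ω → Fin n → ℝ) (J : Set ℝ) (p : ℝ → (Fin n → ℝ) → ℝ) : Prop :=
  ∀ᵐ s ∂(P.map S),
    condDistrib Y S P s = (volume.restrict J).withDensity (fun y => ENNReal.ofReal (p y s))

/-- The partial derivative of `F : ℝⁿ → ℝ` in the `l`-th variable, at the point `s`. -/
def partialDeriv {n : ℕ} (F : (Fin n → ℝ) → ℝ) (l : Fin n) (s : Fin n → ℝ) : ℝ :=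
  deriv (fun r => F (Function.update s l r)) (s l)

/-- `F : ℝⁿ → ℝ` has a partial derivative in the `l`-th variable at the point `s`. -/
def PartialDifferentiableAt {n : ℕ} (F : (Fin n → ℝ) → ℝ) (l : Fin n) (s : Fin n → ℝ) : Prop :=
  DifferentiableAt ℝ (fun r => F (Function.update s l r)) (s l)

/-- The log-density `η(y, s) = log p(y | s)`. -/
def logDensity {n : ℕ} (p : ℝ → (Fin n → ℝ) → ℝ) (y : ℝ) (s : Fin n → ℝ) : ℝ :=
  Real.log (p y s)

/-- `∂η/∂y`. -/
def dLogDensity {n : ℕ} (p : ℝ → (Fin n → ℝ) → ℝ) (y : ℝ) (s : Fin n → ℝ) : ℝ :=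
  deriv (fun y' => logDensity p y' s) y

/-- `∂²η/∂y²`. -/
def ddLogDensity {n : ℕ} (p : ℝ → (Fin n → ℝ) → ℝ) (y : ℝ) (s : Fin n → ℝ) : ℝ :=
  deriv (fun y' => dLogDensity p y' s) y

/-- All derivatives that enter the vectors `v` and `v̊` below exist for `y ∈ J` and `s ∈ U`:
`η` is twice differentiable in `y`, and `∂η/∂y` and `∂²η/∂y²` are differentiable in each coordinate
`s l`. No continuity of the derivatives is asked for. -/
structure RegularLogDensity {n : ℕ} (p : ℝ → (Fin n → ℝ) → ℝ) (J : Set ℝ)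
    (U : Set (Fin n → ℝ)) : Prop where
  diff_one : ∀ s ∈ U, ∀ y ∈ J, DifferentiableAt ℝ (fun y' => logDensity p y' s) y
  diff_two : ∀ s ∈ U, ∀ y ∈ J, DifferentiableAt ℝ (fun y' => dLogDensity p y' s) y
  diff_mixed_one : ∀ s ∈ U, ∀ y ∈ J, ∀ l, PartialDifferentiableAt (dLogDensity p y) l s
  diff_mixed_two : ∀ s ∈ U, ∀ y ∈ J, ∀ l, PartialDifferentiableAt (ddLogDensity p y) l s

/-- The vector `v = (∂²η/∂y∂s₁, …, ∂²η/∂y∂sₙ)`. -/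
def vVec {n : ℕ} (p : ℝ → (Fin n → ℝ) → ℝ) (y : ℝ) (s : Fin n → ℝ) : Fin n → ℝ :=
  fun l => partialDeriv (dLogDensity p y) l s

/-- The vector `v̊ = (∂³η/∂y²∂s₁, …, ∂³η/∂y²∂sₙ)`. -/
def vRingVec {n : ℕ} (p : ℝ → (Fin n → ℝ) → ℝ) (y : ℝ) (s : Fin n → ℝ) : Fin n → ℝ :=
  fun l => partialDeriv (ddLogDensity p y) l s

/-- For every `y ∈ U`, the `2n` vector-valued functions `s ↦ v_k(y_k, s)` and `s ↦ v̊_k(y_k, s)` on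
`U`, `k = 1, …, n`, are linearly independent over `ℝ`. -/
def LinIndepCondition {n : ℕ} (p : Fin n → ℝ → (Fin n → ℝ) → ℝ) (U : Set (Fin n → ℝ)) : Prop :=
  ∀ y ∈ U, LinearIndependent ℝ
    (Sum.elim (fun (k : Fin n) (s : U) => vVec (p k) (y k) (s : Fin n → ℝ))
      (fun (k : Fin n) (s : U) => vRingVec (p k) (y k) (s : Fin n → ℝ)) :
      Fin n ⊕ Fin n → U → Fin n → ℝ)

/-- `φ` is twice continuously differentiable on `U` with non-singular Jacobian matrix. For `U` open
and `φ` injective on `U`, this says that `φ` is a `C²` diffeomorphism of `U` onto the open set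
`φ(U)`. -/
def IsRegularC2On {n : ℕ} (φ : (Fin n → ℝ) → Fin n → ℝ) (U : Set (Fin n → ℝ)) : Prop :=
  ContDiffOn ℝ 2 φ U ∧ ∀ y ∈ U, (fderiv ℝ φ y).det ≠ 0

end

/-! Write `φ = ghat ∘ g`, with local inverse `ψ`. Since `φ` is injective, conditioning on `φ ∘ S` is
the same as conditioning on `S`. So for almost every `s`, the conditional law of `z t` given `s` is
a product, and so is its image under `φ`. Comparing `s` with a reference value `s₀`, the density
ratio of the two images is a product of one-variable functions; pulled back by `φ`, the sum over `k`
of `log p k (y k) s - log p k (y k) s₀` is almost everywhere a sum of functions of the single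
components of `φ y` (`exists_sum_log_sub_log_eq`). No density or smoothness of the estimated law is
needed: mixed second differences kill such a sum, and continuity removes the exceptional set
(`mixed_deriv_eq_zero`).

In the coordinates `u = φ y`, the vanishing mixed derivative is a linear relation between first and
second log-density derivatives, with coefficients `∂ⱼψₖ ∂ᵢψₖ` and `∂ⱼ∂ᵢψₖ`, whose value does not
depend on `s`. Differentiating in `s` and using linear independence gives `∂ⱼψₖ ∂ᵢψₖ = 0` for `i ≠
j` (`coeff_eq_zero_of_linIndepCondition`). Hence the Jacobian matrix of `φ` is a scaled permutation
matrix at each point. Its pattern is locally constant, so constant on the connected box, and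
integrating along segments makes `φ` component-wise (`exists_perm_componentwise_inverse`). -/

/-! ### Densities of product measures -/

lemma lintegral_pi_prod_eq_prod {n : ℕ} (μ : Fin n → Measure ℝ) [∀ k, SigmaFinite (μ k)]
    (f : Fin n → ℝ → ENNReal) (hf : ∀ k, Measurable (f k)) :
    ∫⁻ y, ∏ k, f k (y k) ∂Measure.pi μ = ∏ k, ∫⁻ a, f k a ∂μ k := by
  induction n with
  | zero => simp
  | succ n ih =>
    rw [← ((measurePreserving_piFinSuccAbove μ 0).symm).lintegral_comp_emb
      (MeasurableEquiv.measurableEmbedding _)]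
    simp_rw [MeasurableEquiv.piFinSuccAbove_symm_apply, Fin.insertNthEquiv,
      Fin.prod_univ_succ, Fin.insertNth_zero]
    simp only [Fin.zero_succAbove, Equiv.coe_fn_mk, Fin.cons_succ, Fin.cons_zero, cast_eq]
    rw [lintegral_prod_mul (f := f 0) (g := fun y : Fin n → ℝ => ∏ k, f k.succ (y k))
      (hf 0).aemeasurable
      (Finset.measurable_prod _ fun k _ => (hf k.succ).comp (measurable_pi_apply k)).aemeasurable,
      ih (fun k => μ k.succ) (fun k => f k.succ) fun k => hf _]

lemma pi_withDensity_eq {n : ℕ} (μ : Fin n → Measure ℝ) [∀ k, SigmaFinite (μ k)]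
    (f : Fin n → ℝ → ENNReal) (hf : ∀ k, Measurable (f k))
    [∀ k, SigmaFinite ((μ k).withDensity (f k))] :
    Measure.pi (fun k => (μ k).withDensity (f k)) =
      (Measure.pi μ).withDensity (fun y => ∏ k, f k (y k)) := by
  refine Measure.pi_eq fun A hA => ?_
  rw [withDensity_apply _ (MeasurableSet.univ_pi hA), ← lintegral_indicator (.univ_pi hA)]
  have : ∀ y : Fin n → ℝ, (Set.univ.pi A).indicator (fun y => ∏ k, f k (y k)) y =
      ∏ k, (A k).indicator (f k) (y k) := by
    intro y
    by_cases hy : y ∈ Set.univ.pi A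
    · rw [Set.indicator_of_mem hy]
      exact Finset.prod_congr rfl fun k _ => (Set.indicator_of_mem (hy k trivial) _).symm
    · rw [Set.indicator_of_notMem hy]
      simp only [Set.mem_univ_pi, not_forall] at hy
      obtain ⟨k, hk⟩ := hy
      exact (Finset.prod_eq_zero (Finset.mem_univ k) (Set.indicator_of_notMem hk _)).symm
  simp_rw [this]
  rw [lintegral_pi_prod_eq_prod μ _ fun k => (hf k).indicator (hA k)]
  refine Finset.prod_congr rfl fun k _ => ?_
  rw [lintegral_indicator (hA k), withDensity_apply _ (hA k)]

/-- If an injective map sends two probability measures to product measures, the density of one with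
respect to the other is a product of functions of the components of the map. -/
lemma exists_prod_density_of_map_eq_pi {n : ℕ} {Z : Set (Fin n → ℝ)} (hZ : MeasurableSet Z)
    {φ : (Fin n → ℝ) → Fin n → ℝ} (hφ : Measurable φ) (hφc : ContinuousOn φ Z)
    (hinj : Set.InjOn φ Z)
    {M M' : Measure (Fin n → ℝ)} (hM : M Zᶜ = 0) (hM' : M' Zᶜ = 0) (hac : M ≪ M')
    {ν ν' : Fin n → Measure ℝ} [∀ k, IsProbabilityMeasure (ν k)]
    [∀ k, IsProbabilityMeasure (ν' k)]
    (hν : M.map φ = Measure.pi ν) (hν' : M'.map φ = Measure.pi ν') :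
    ∃ r : Fin n → ℝ → ENNReal, (∀ k, Measurable (r k)) ∧
      M = M'.withDensity (fun y => ∏ k, r k (φ y k)) := by
  have hk : ∀ k, ν k ≪ ν' k := by
    intro k
    have h1 := (measurePreserving_eval ν k).map_eq
    have h2 := (measurePreserving_eval ν' k).map_eq
    rw [← h1, ← h2, ← hν, ← hν']
    exact (hac.map hφ).map (measurable_pi_apply k)
  have hr : ∀ k, Measurable ((ν k).rnDeriv (ν' k)) := fun k => Measure.measurable_rnDeriv _ _
  refine ⟨fun k => (ν k).rnDeriv (ν' k), hr, ?_⟩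
  have hd : ∀ k, (ν' k).withDensity ((ν k).rnDeriv (ν' k)) = ν k := fun k =>
    Measure.withDensity_rnDeriv_eq _ _ (hk k)
  have : ∀ k, SigmaFinite ((ν' k).withDensity ((ν k).rnDeriv (ν' k))) := fun k => by
    rw [hd k]; infer_instance
  have hpi := pi_withDensity_eq ν' (fun k => (ν k).rnDeriv (ν' k)) hr
  simp_rw [hd] at hpi
  have hQ : Measurable fun u : Fin n → ℝ => ∏ k, (ν k).rnDeriv (ν' k) (u k) :=
    Finset.measurable_prod _ fun k _ => (hr k).comp (measurable_pi_apply k)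
  ext A hA
  -- By the Lusin–Souslin theorem injective images stay measurable, so each measurable `A` is, up to
  -- null sets, the preimage of a measurable set, and the identity between image measures pulls
  -- back.
  have hAZ : MeasurableSet (φ '' (A ∩ Z)) :=
    (hA.inter hZ).image_of_continuousOn_injOn (hφc.mono Set.inter_subset_right)
      (hinj.mono Set.inter_subset_right)
  have hpre : φ ⁻¹' (φ '' (A ∩ Z)) ∩ Z = A ∩ Z := by
    ext y
    constructor
    · rintro ⟨⟨w, hw, hwy⟩, hy⟩
      rwa [← hinj hw.2 hy hwy]
    · exact fun hy => ⟨⟨y, hy, rfl⟩, hy.2⟩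
  have hae : ∀ N : Measure (Fin n → ℝ), N Zᶜ = 0 →
      φ ⁻¹' (φ '' (A ∩ Z)) =ᵐ[N] A := by
    intro N hN
    have hz : ∀ᵐ y ∂N, y ∈ Z := hN
    filter_upwards [hz] with y hy
    have := Set.ext_iff.1 hpre y
    simp only [Set.mem_inter_iff, hy, and_true] at this
    exact propext this
  rw [← measure_congr (hae M hM), ← Measure.map_apply hφ hAZ, hν, hpi,
    withDensity_apply _ hAZ, ← hν', setLIntegral_map hAZ hQ hφ,
    setLIntegral_congr (hae M' hM'), withDensity_apply _ hA]

/-! ### Conditional independence and product conditional laws -/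

/-- Conditional independence gives the product formula only up to a null set for each event. Boxes
with rational endpoints form a countable generating π-system, so one null set serves for all of
them. -/
lemma condDistrib_eq_pi_of_condIndepComponents {Ω : Type*} [MeasurableSpace Ω]
    [StandardBorelSpace Ω] (P : Measure Ω) [IsProbabilityMeasure P] {n : ℕ}
    {Y S : Ω → Fin n → ℝ} (hY : Measurable Y) (hS : Measurable S)
    (h : CondIndepComponents P Y S hS) :
    ∀ᵐ s ∂(P.map S), condDistrib Y S P s =
      Measure.pi (fun k => (condDistrib Y S P s).map (fun y => y k)) := by
  have hYk : ∀ k, Measurable fun ω => Y ω k := fun k => (measurable_pi_apply k).comp hY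
  have key : ∀ q : Fin n → ℚ, ∀ᵐ s ∂(P.map S),
      (condDistrib Y S P s).real (Set.univ.pi fun k => Set.Iic (q k : ℝ)) =
        ∏ k, (condDistrib Y S P s).real ((fun y => y k) ⁻¹' Set.Iic (q k : ℝ)) := by
    intro q
    have hm : ∀ A : Set (Fin n → ℝ), MeasurableSet A →
        Measurable fun s => (condDistrib Y S P s).real A := fun A hA =>
      (Kernel.measurable_coe _ hA).ennreal_toReal
    have hpi : MeasurableSet (Set.univ.pi fun k => Set.Iic (q k : ℝ)) :=
      MeasurableSet.univ_pi fun k => measurableSet_Iic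
    have hk : ∀ k, MeasurableSet ((fun y : Fin n → ℝ => y k) ⁻¹' Set.Iic (q k : ℝ)) := fun k =>
      measurable_pi_apply k measurableSet_Iic
    rw [ae_map_iff hS.aemeasurable
      (measurableSet_eq_fun (hm _ hpi) (Finset.measurable_prod _ fun k _ => hm _ (hk k)))]
    have h1 := (iCondIndepFun_iff_condExp_inter_preimage_eq_mul _ _ hYk).1 h Finset.univ
      (sets := fun k => Set.Iic (q k : ℝ)) fun k _ => measurableSet_Iic
    have h2 := condDistrib_ae_eq_condExp (μ := P) hS hY hpi
    have h3 := fun k => condDistrib_ae_eq_condExp (μ := P) hS hY (hk k)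
    have hset : (⋂ k ∈ (Finset.univ : Finset (Fin n)), (fun ω => Y ω k) ⁻¹' Set.Iic (q k : ℝ)) =
        Y ⁻¹' (Set.univ.pi fun k => Set.Iic (q k : ℝ)) := by
      ext ω; simp [Pi.le_def]
    rw [hset] at h1
    filter_upwards [h1, h2, ae_all_iff.2 h3] with ω a1 a2 a3
    rw [a2, a1, Finset.prod_apply]
    exact Finset.prod_congr rfl fun k _ => (a3 k).symm
  filter_upwards [ae_all_iff.2 key] with s hs
  have : ∀ k, IsProbabilityMeasure ((condDistrib Y S P s).map (fun y => y k)) := fun k =>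
    Measure.isProbabilityMeasure_map (measurable_pi_apply k).aemeasurable
  refine (Measure.pi_eq_generateFrom (C := fun _ => ⋃ a : ℚ, {Set.Iic (a : ℝ)})
    (fun _ => ?_) (fun _ => Real.isPiSystem_Iic_rat) (fun k => ?_) ?_).symm
  · rw [← Real.borel_eq_generateFrom_Iic_rat]; exact BorelSpace.measurable_eq.symm
  · refine ⟨fun m => Set.Iic (m : ℝ), fun m => ?_, fun m => measure_lt_top _ _, ?_⟩
    · simp only [Set.mem_iUnion, Set.mem_singleton_iff]
      exact ⟨m, by simp⟩
    · refine Set.eq_univ_of_forall fun a => ?_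
      obtain ⟨m, hm⟩ := exists_nat_ge a
      exact Set.mem_iUnion.2 ⟨m, hm⟩
  · intro A hA
    simp only [Set.mem_iUnion, Set.mem_singleton_iff] at hA
    choose q hq using hA
    obtain rfl : A = fun k => Set.Iic (q k : ℝ) := funext hq
    have := hs q
    simp only [measureReal_def, ← ENNReal.toReal_prod] at this
    rw [ENNReal.toReal_eq_toReal_iff' (measure_ne_top _ _)
      (ENNReal.prod_ne_top fun _ _ => measure_ne_top _ _)] at this
    rw [this]
    exact Finset.prod_congr rfl fun k _ =>
      (Measure.map_apply (measurable_pi_apply k) measurableSet_Iic).symm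

lemma comap_comp_eq_of_injOn {Ω : Type*} {n : ℕ} {Z : Set (Fin n → ℝ)} (hZ : MeasurableSet Z)
    {φ : (Fin n → ℝ) → Fin n → ℝ} (hφ : Measurable φ) (hφc : ContinuousOn φ Z)
    (hinj : Set.InjOn φ Z) {S : Ω → Fin n → ℝ} (hS : ∀ ω, S ω ∈ Z) :
    MeasurableSpace.comap (φ ∘ S) inferInstance = MeasurableSpace.comap S inferInstance := by
  apply le_antisymm
  · rw [← MeasurableSpace.comap_comp]
    exact MeasurableSpace.comap_mono hφ.comap_le
  · rintro _ ⟨A, hA, rfl⟩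
    refine ⟨φ '' (A ∩ Z), (hA.inter hZ).image_of_continuousOn_injOn
      (hφc.mono Set.inter_subset_right) (hinj.mono Set.inter_subset_right), ?_⟩
    ext ω
    constructor
    · rintro ⟨w, hw, hwy⟩
      rw [hinj hw.2 (hS ω) hwy] at hw
      exact hw.1
    · exact fun h => ⟨S ω, ⟨h, hS ω⟩, rfl⟩

/-! ### From almost everywhere to everywhere; mixed derivatives -/

/-- Coordinate-wise differentiability does not give joint continuity, so a density argument in `ℝⁿ`
is unavailable. Fubini and induction handle almost every slice; continuity in the first coordinate
then reaches the remaining ones. -/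
lemma eq_of_ae_eq_of_separately_continuousAt {n : ℕ} (I : Fin n → Set ℝ)
    (hI : ∀ k, IsOpen (I k)) (F : (Fin n → ℝ) → ℝ) (c : ℝ)
    (hF : ∀ s ∈ latentSpace I, ∀ l, ContinuousAt (fun r => F (Function.update s l r)) (s l))
    (h : ∀ᵐ s, s ∈ latentSpace I → F s = c) : ∀ s ∈ latentSpace I, F s = c := by
  induction n with
  | zero =>
    intro s hs
    rw [Measure.volume_pi_eq_dirac s, ae_dirac_eq] at h
    exact h hs
  | succ n ih =>
    have hmem : ∀ r (s : Fin n → ℝ), (Fin.cons r s : Fin (n + 1) → ℝ) ∈ latentSpace I ↔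
        r ∈ I 0 ∧ s ∈ latentSpace (fun k => I k.succ) := by
      intro r s
      simp [latentSpace, Fin.forall_fin_succ]
    have h1 := ((volume_preserving_piFinSuccAbove (fun _ : Fin (n + 1) => ℝ) 0).symm
      ).quasiMeasurePreserving.ae h
    simp_rw [MeasurableEquiv.piFinSuccAbove_symm_apply, Fin.insertNthEquiv, Equiv.coe_fn_mk,
      Fin.insertNth_zero'] at h1
    have h2 := Measure.ae_ae_of_ae_prod h1
    have h3 : ∀ᵐ r : ℝ, r ∈ I 0 → ∀ s ∈ latentSpace (fun k => I k.succ),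
        F (Fin.cons r s : Fin (n + 1) → ℝ) = c := by
      filter_upwards [h2] with r hr hrI
      refine ih (fun k => I k.succ) (fun k => hI _) (fun s => F (Fin.cons r s : Fin (n + 1) → ℝ))
        ?_ ?_
      · intro s hs l
        have := hF _ ((hmem r s).2 ⟨hrI, hs⟩) l.succ
        simpa only [Fin.cons_update, Fin.cons_succ] using this
      · filter_upwards [hr] with s hs hsZ
        exact hs ((hmem r s).2 ⟨hrI, hsZ⟩)
    intro s hs
    obtain ⟨r, s, rfl⟩ : ∃ r s', s = (Fin.cons r s' : Fin (n + 1) → ℝ) :=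
      ⟨s 0, Fin.tail s, (Fin.cons_self_tail s).symm⟩
    obtain ⟨hr, hs⟩ := (hmem r s).1 hs
    have h4 : (fun r => F (Fin.cons r s : Fin (n + 1) → ℝ)) =ᵐ[volume.restrict (I 0)]
        fun _ => c := by
      rw [Filter.EventuallyEq, ae_restrict_iff' (hI 0).measurableSet]
      filter_upwards [h3] with r hr hrI using hr hrI s hs
    refine Measure.eqOn_open_of_ae_eq h4 (hI 0) (fun q hq => ?_) continuousOn_const hr
    have := hF _ ((hmem q s).2 ⟨hq, hs⟩) 0
    simp only [Fin.update_cons_zero, Fin.cons_zero] at this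
    exact this.continuousWithinAt

/-- A continuous function which is almost everywhere a sum of functions of one coordinate has
vanishing mixed second differences. -/
lemma mixed_difference_eq_zero {n : ℕ} {V : Set (Fin n → ℝ)} (hV : IsOpen V)
    {H : (Fin n → ℝ) → ℝ} (hH : ContinuousOn H V) (c : Fin n → ℝ → ℝ)
    (hc : ∀ᵐ u, u ∈ V → H u = ∑ k, c k (u k)) {i j : Fin n} (hij : i ≠ j) (a b : ℝ)
    {u : Fin n → ℝ} (h0 : u ∈ V) (h1 : u + Pi.single i a ∈ V) (h2 : u + Pi.single j b ∈ V)
    (h3 : u + Pi.single j b + Pi.single i a ∈ V) :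
    H (u + Pi.single j b + Pi.single i a) =
      H (u + Pi.single i a) + H (u + Pi.single j b) - H u := by
  have hshift : ∀ w : Fin n → ℝ, Continuous fun v : Fin n → ℝ => v + w := fun w => by fun_prop
  -- The base points for which all four corners of the parallelogram lie in `V`.
  set O : Set (Fin n → ℝ) := V ∩ ((fun v => v + Pi.single i a) ⁻¹' V) ∩
    ((fun v => v + Pi.single j b) ⁻¹' V) ∩
    ((fun v => v + (Pi.single j b + Pi.single i a)) ⁻¹' V) with hO
  have hOo : IsOpen O := ((hV.inter (hV.preimage (hshift _))).inter
    (hV.preimage (hshift _))).inter (hV.preimage (hshift _))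
  have hae : ∀ w : Fin n → ℝ, ∀ᵐ u : Fin n → ℝ, u + w ∈ V → H (u + w) = ∑ k, c k ((u + w) k) :=
    fun w => (measurePreserving_add_right volume w).quasiMeasurePreserving.ae hc
  have hcont : ∀ w : Fin n → ℝ, (∀ v ∈ O, v + w ∈ V) → ContinuousOn (fun v => H (v + w)) O :=
    fun w hw => hH.comp (hshift w).continuousOn hw
  have key : (fun v => H (v + (Pi.single j b + Pi.single i a))) =ᵐ[volume.restrict O]
      fun v => H (v + Pi.single i a) + H (v + Pi.single j b) - H v := by
    rw [Filter.EventuallyEq, ae_restrict_iff' hOo.measurableSet]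
    filter_upwards [hc, hae (Pi.single i a), hae (Pi.single j b),
      hae (Pi.single j b + Pi.single i a)] with v e0 e1 e2 e3 hv
    rw [e0 hv.1.1.1, e1 hv.1.1.2, e2 hv.1.2, e3 hv.2, ← Finset.sum_add_distrib,
      ← Finset.sum_sub_distrib]
    refine Finset.sum_congr rfl fun k _ => ?_
    rcases eq_or_ne k i with rfl | hki
    · simp [Pi.single_eq_of_ne hij]
    · simp [Pi.single_eq_of_ne hki]
  have := Measure.eqOn_open_of_ae_eq key hOo (hcont _ fun v hv => hv.2)
    (((hcont _ fun v hv => hv.1.1.2).add (hcont _ fun v hv => hv.1.2)).sub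
      (hH.mono fun v hv => hv.1.1.1))
    (show u ∈ O from ⟨⟨⟨h0, h1⟩, h2⟩, by rwa [add_assoc] at h3⟩)
  simpa only [add_assoc] using this

/-- Near `u`, the increment of `H` in direction `i` is unchanged by a small shift in direction `j`,
so the partial derivative `G` is constant along that shift. -/
lemma mixed_deriv_eq_zero {n : ℕ} {V : Set (Fin n → ℝ)} (hV : IsOpen V)
    {H : (Fin n → ℝ) → ℝ} (hH : ContinuousOn H V) (c : Fin n → ℝ → ℝ)
    (hc : ∀ᵐ u, u ∈ V → H u = ∑ k, c k (u k)) {i j : Fin n} (hij : i ≠ j)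
    {u : Fin n → ℝ} (hu : u ∈ V) {G : (Fin n → ℝ) → ℝ}
    (hG : ∀ v ∈ V, HasDerivAt (fun a : ℝ => H (v + Pi.single i a)) (G v) 0) {g : ℝ}
    (hg : HasDerivAt (fun b : ℝ => G (u + Pi.single j b)) g 0) : g = 0 := by
  have hnear : ∀ v ∈ V, ∀ l, ∀ᶠ b : ℝ in nhds 0, v + Pi.single l b ∈ V := by
    intro v hv l
    have hcont : Continuous fun b : ℝ => v + Pi.single l b :=
      continuous_const.add (continuous_single (A := fun _ : Fin n => ℝ) l)
    exact hcont.continuousAt.eventually_mem (hV.mem_nhds (by simpa using hv))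
  have hconst : (fun b : ℝ => G (u + Pi.single j b)) =ᶠ[nhds 0] fun _ => G u := by
    filter_upwards [hnear u hu j] with b hb
    refine (hG _ hb).unique ?_
    have h1 : HasDerivAt (fun a : ℝ => H (u + Pi.single i a) + H (u + Pi.single j b) - H u)
        (G u) 0 := ((hG u hu).add_const _).sub_const _
    refine h1.congr_of_eventuallyEq ?_
    filter_upwards [hnear u hu i, hnear _ hb i] with a ha hab
    exact mixed_difference_eq_zero hV hH c hc hij a b hu ha hb hab
  exact (hg.congr_of_eventuallyEq hconst.symm).unique (hasDerivAt_const _ _)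

lemma hasDerivAt_add_single {n : ℕ} {ψ : (Fin n → ℝ) → Fin n → ℝ} {u : Fin n → ℝ}
    (h : DifferentiableAt ℝ ψ u) (i k : Fin n) :
    HasDerivAt (fun a : ℝ => ψ (u + Pi.single i a) k) (fderiv ℝ ψ u (Pi.single i 1) k) 0 := by
  have h1 : HasDerivAt (fun a : ℝ => u + Pi.single i a) (Pi.single i 1) 0 :=
    (hasDerivAt_single i 0).const_add u
  have h2 : HasFDerivAt ψ (fderiv ℝ ψ u) (u + Pi.single i (0 : ℝ)) := by
    simpa using h.hasFDerivAt
  exact hasDerivAt_pi.1 (h2.comp_hasDerivAt 0 h1) k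

/-- If `∑ δₖ(ψₖ)` is a sum of functions of one coordinate, its mixed second derivatives vanish. -/
lemma sum_mixed_deriv_comp_eq_zero {n : ℕ} {I : Fin n → Set ℝ} {V : Set (Fin n → ℝ)}
    (hV : IsOpen V) {ψ : (Fin n → ℝ) → Fin n → ℝ} (hψ : ∀ u ∈ V, ContDiffAt ℝ 2 ψ u)
    (hψI : ∀ u ∈ V, ψ u ∈ latentSpace I) {δ δ' δ'' : Fin n → ℝ → ℝ}
    (hδ : ∀ k, ∀ y ∈ I k, HasDerivAt (δ k) (δ' k y) y)
    (hδ' : ∀ k, ∀ y ∈ I k, HasDerivAt (δ' k) (δ'' k y) y) (c : Fin n → ℝ → ℝ)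
    (hc : ∀ᵐ u, u ∈ V → ∑ k, δ k (ψ u k) = ∑ k, c k (u k)) {i j : Fin n} (hij : i ≠ j)
    {u : Fin n → ℝ} (hu : u ∈ V) :
    ∑ k, (δ'' k (ψ u k) *
        (fderiv ℝ ψ u (Pi.single j 1) k * fderiv ℝ ψ u (Pi.single i 1) k) +
      δ' k (ψ u k) * deriv (fun b : ℝ => fderiv ℝ ψ (u + Pi.single j b) (Pi.single i 1) k) 0) =
      0 := by
  have hd : ∀ v ∈ V, DifferentiableAt ℝ ψ v := fun v hv => (hψ v hv).differentiableAt two_ne_zero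
  have hH : ContinuousOn (fun u => ∑ k, δ k (ψ u k)) V := by
    refine continuousOn_finsetSum _ fun k _ v hv => ContinuousAt.continuousWithinAt ?_
    exact ContinuousAt.comp (g := δ k) (f := fun u => ψ u k)
      (hδ k _ (hψI v hv k trivial)).continuousAt
      ((continuous_apply k).continuousAt.comp (hd v hv).continuousAt)
  refine mixed_deriv_eq_zero hV hH c hc hij hu
    (G := fun v => ∑ k, δ' k (ψ v k) * fderiv ℝ ψ v (Pi.single i 1) k) ?_ ?_
  · intro v hv
    refine HasDerivAt.fun_sum fun k _ => ?_
    refine HasDerivAt.comp (h₂ := δ k) (h := fun a : ℝ => ψ (v + Pi.single i a) k) 0 ?_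
      (hasDerivAt_add_single (hd v hv) i k)
    simpa using hδ k _ (hψI v hv k trivial)
  · refine HasDerivAt.fun_sum fun k _ => ?_
    have h1 : HasDerivAt (fun b : ℝ => δ' k (ψ (u + Pi.single j b) k))
        (δ'' k (ψ u k) * fderiv ℝ ψ u (Pi.single j 1) k) 0 := by
      refine HasDerivAt.comp (h₂ := δ' k) (h := fun a : ℝ => ψ (u + Pi.single j a) k) 0 ?_
        (hasDerivAt_add_single (hd u hu) j k)
      simpa using hδ' k _ (hψI u hu k trivial)
    have h2 : DifferentiableAt ℝ
        (fun b : ℝ => fderiv ℝ ψ (u + Pi.single j b) (Pi.single i 1) k) 0 := by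
      have h3 : DifferentiableAt ℝ (fderiv ℝ ψ) (u + Pi.single j (0 : ℝ)) := by
        simpa using ((hψ u hu).fderiv_right (m := 1) le_rfl).differentiableAt one_ne_zero
      have h4 : DifferentiableAt ℝ (fun b : ℝ => u + Pi.single j b) 0 :=
        ((hasDerivAt_single j 0).const_add u).differentiableAt
      have h5 : DifferentiableAt ℝ (fun b : ℝ => fderiv ℝ ψ (u + Pi.single j b)) 0 :=
        h3.comp (0 : ℝ) h4
      exact differentiableAt_pi.1 (h5.clm_apply (differentiableAt_const _)) k
    refine (h1.fun_mul h2.hasDerivAt).congr_deriv ?_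
    simp only [Pi.single_zero, add_zero]
    ring

/-! ### Scaled permutation Jacobians and component-wise maps -/

lemma clm_apply_eq_sum_mul_single {n : ℕ} (J : (Fin n → ℝ) →L[ℝ] (Fin n → ℝ)) (v : Fin n → ℝ)
    (k : Fin n) : J v k = ∑ i, v i * J (Pi.single i 1) k := by
  conv_lhs => rw [← Finset.univ_sum_single v]
  rw [map_sum, Finset.sum_apply]
  refine Finset.sum_congr rfl fun i _ => ?_
  rw [show (Pi.single i (v i) : Fin n → ℝ) = v i • Pi.single i 1 by
    rw [← Pi.single_smul, smul_eq_mul, mul_one], map_smul, Pi.smul_apply, smul_eq_mul]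

/-- Each row of `J` has at most one nonzero entry by `hJ`, and at least one because `J` is onto; `σ
k` is its column. Row `k` of `J K = 1` then determines row `σ k` of `K`. -/
lemma exists_injective_support_of_leftInverse {n : ℕ} {J K : (Fin n → ℝ) →L[ℝ] (Fin n → ℝ)}
    (hJK : ∀ v, J (K v) = v)
    (hJ : ∀ k i j, i ≠ j → J (Pi.single j 1) k * J (Pi.single i 1) k = 0) :
    ∃ σ : Fin n → Fin n, Function.Injective σ ∧
      ∀ k l, K (Pi.single l 1) (σ k) ≠ 0 ↔ l = k := by
  have hex : ∀ k, ∃ i, J (Pi.single i 1) k ≠ 0 := by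
    intro k
    by_contra! h
    have := clm_apply_eq_sum_mul_single J (K (Pi.single k 1)) k
    simp [hJK, h] at this
  choose σ hσ using hex
  have hK : ∀ k l, (Pi.single l 1 : Fin n → ℝ) k =
      K (Pi.single l 1) (σ k) * J (Pi.single (σ k) 1) k := by
    intro k l
    have := clm_apply_eq_sum_mul_single J (K (Pi.single l 1)) k
    rw [hJK, Finset.sum_eq_single (σ k)] at this
    · exact this
    · intro i _ hi
      rw [(mul_eq_zero.1 (hJ k i (σ k) hi)).resolve_left (hσ k), mul_zero]
    · simp
  have hiff : ∀ k l, K (Pi.single l 1) (σ k) ≠ 0 ↔ l = k := by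
    intro k l
    constructor
    · intro h
      by_contra hlk
      have := hK k l
      rw [Pi.single_eq_of_ne (Ne.symm hlk)] at this
      exact mul_ne_zero h (hσ k) this.symm
    · rintro rfl h
      have := hK l l
      simp [h] at this
  refine ⟨σ, fun k k' h => ?_, hiff⟩
  have h1 := (hiff k k).2 rfl
  rw [h] at h1
  exact (hiff k' k).1 h1

lemma isOpen_latentSpace {n : ℕ} {I : Fin n → Set ℝ} (hI : ∀ k, IsOpen (I k)) :
    IsOpen (latentSpace I) :=
  isOpen_set_pi Set.finite_univ fun k _ => hI k

lemma convex_latentSpace {n : ℕ} {I : Fin n → Set ℝ} (hI : ∀ k, (I k).OrdConnected) :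
    Convex ℝ (latentSpace I) :=
  convex_pi fun k _ => (hI k).convex

lemma apply_eq_of_fderiv_single_eq_zero {n : ℕ} {I : Fin n → Set ℝ}
    (hI : ∀ k, (I k).OrdConnected) {φ : (Fin n → ℝ) → Fin n → ℝ}
    (hd : ∀ y ∈ latentSpace I, DifferentiableAt ℝ φ y) {k m : Fin n}
    (h0 : ∀ y ∈ latentSpace I, ∀ l, l ≠ k → fderiv ℝ φ y (Pi.single l 1) m = 0)
    {y w : Fin n → ℝ} (hy : y ∈ latentSpace I) (hw : w ∈ latentSpace I) (hyw : y k = w k) :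
    φ y m = φ w m := by
  have hmem : ∀ r ∈ Set.Icc (0 : ℝ) 1, y + r • (w - y) ∈ latentSpace I := fun r hr =>
    (convex_latentSpace hI).add_smul_sub_mem hy hw hr
  have hder : ∀ r ∈ Set.Icc (0 : ℝ) 1,
      HasDerivAt (fun r : ℝ => φ (y + r • (w - y)) m) 0 r := by
    intro r hr
    have h1 : HasDerivAt (fun r : ℝ => y + r • (w - y)) (w - y) r := by
      simpa using ((hasDerivAt_id r).smul_const (w - y)).const_add y
    have h2 := hasDerivAt_pi.1 ((hd _ (hmem r hr)).hasFDerivAt.comp_hasDerivAt r h1) m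
    refine h2.congr_deriv ?_
    rw [clm_apply_eq_sum_mul_single]
    refine Finset.sum_eq_zero fun l _ => ?_
    rcases eq_or_ne l k with rfl | hl
    · simp [hyw]
    · rw [h0 _ (hmem r hr) l hl, mul_zero]
  have := constant_of_has_deriv_right_zero (fun r hr => (hder r hr).continuousAt.continuousWithinAt)
    (fun r hr => (hder r ⟨hr.1, hr.2.le⟩).hasDerivWithinAt) 1 ⟨zero_le_one, le_rfl⟩
  simpa using this.symm

/-- An injective map on a box whose Jacobian matrix is everywhere a scaled permutation matrix is a
permutation of injective functions of the coordinates. -/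
lemma exists_perm_componentwise_inverse {n : ℕ} {I : Fin n → Set ℝ}
    (hI : ∀ k, (I k).OrdConnected)
    (hne : (latentSpace I).Nonempty) {φ : (Fin n → ℝ) → Fin n → ℝ}
    (hd : ∀ y ∈ latentSpace I, DifferentiableAt ℝ φ y)
    (hc : ContinuousOn (fderiv ℝ φ) (latentSpace I)) (hinj : Set.InjOn φ (latentSpace I))
    (hσ : ∀ y ∈ latentSpace I, ∃ σ : Fin n → Fin n, Function.Injective σ ∧
      ∀ k l, fderiv ℝ φ y (Pi.single l 1) (σ k) ≠ 0 ↔ l = k) :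
    ∃ (π : Equiv.Perm (Fin n)) (T : Fin n → ℝ → ℝ),
      (∀ k, Set.BijOn (T k) ((fun y => φ y (π k)) '' latentSpace I) (I k)) ∧
      ∀ y ∈ latentSpace I, ∀ k, y k = T k (φ y (π k)) := by
  classical
  have : Nonempty (Fin n → Fin n) := ⟨id⟩
  choose! σ hσi hσ using hσ
  obtain ⟨y₀, hy₀⟩ := hne
  have hconst : ∀ y ∈ latentSpace I, ∀ k, σ y k = σ y₀ k := by
    intro y hy k
    refine (convex_latentSpace hI).isPreconnected.constant (f := fun y => σ y k) ?_ hy hy₀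
    intro v hv
    have h1 : ContinuousWithinAt (fun w => fderiv ℝ φ w (Pi.single k 1) (σ v k))
        (latentSpace I) v :=
      (continuous_apply (σ v k)).continuousAt.comp_continuousWithinAt
        ((hc v hv).clm_apply continuousWithinAt_const)
    have h2 := h1.eventually_ne ((hσ v hv k k).2 rfl)
    refine tendsto_nhds_of_eventually_eq ?_
    filter_upwards [h2, self_mem_nhdsWithin] with w hw hwZ
    -- A nonzero entry stays nonzero nearby, and every row has a single nonzero column, so the
    -- pattern at `w` must agree with that at `v` in column `k`.
    obtain ⟨k', hk'⟩ := (Finite.injective_iff_surjective.1 (hσi w hwZ)) (σ v k)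
    rw [← hk'] at hw
    rw [(hσ w hwZ k' k).1 hw, hk', ← (hσ w hwZ k' k).1 hw]
  let π : Equiv.Perm (Fin n) :=
    Equiv.ofBijective (σ y₀) (Finite.injective_iff_bijective.1 (hσi y₀ hy₀))
  have hdep : ∀ k, ∀ y ∈ latentSpace I, ∀ w ∈ latentSpace I, y k = w k →
      φ y (π k) = φ w (π k) := by
    intro k y hy w hw hyw
    refine apply_eq_of_fderiv_single_eq_zero hI hd (fun v hv l hl => ?_) hy hw hyw
    by_contra h
    rw [show π k = σ v k from (hconst v hv k).symm] at h
    exact hl ((hσ v hv k l).1 h)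
  have hupd : ∀ y ∈ latentSpace I, ∀ k, ∀ a ∈ I k, Function.update y k a ∈ latentSpace I := by
    intro y hy k a ha l _
    rcases eq_or_ne l k with rfl | hl
    · simpa using ha
    · rw [Function.update_of_ne hl]; exact hy l trivial
  have hsep : ∀ k, ∀ y ∈ latentSpace I, ∀ w ∈ latentSpace I, φ y (π k) = φ w (π k) →
      y k = w k := by
    intro k y hy w hw h
    -- Replacing `y k` by `w k` can affect only component `π k` of `φ`, which `h` keeps fixed;
    -- injectivity of `φ` finishes.
    have hv := hupd y hy k (w k) (hw k trivial)
    have : φ (Function.update y k (w k)) = φ y := by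
      funext m
      obtain ⟨j, rfl⟩ := π.surjective m
      rcases eq_or_ne j k with rfl | hj
      · rw [h]
        exact hdep j _ hv _ hw (by simp)
      · exact hdep j _ hv _ hy (by rw [Function.update_of_ne hj])
    have := congrFun (hinj hv hy this) k
    simpa using this.symm
  have hinv : ∀ k, ∀ y ∈ latentSpace I,
      y k = Function.invFunOn (fun y => φ y (π k)) (latentSpace I) (φ y (π k)) k := by
    intro k y hy
    have hex : ∃ w ∈ latentSpace I, (fun y => φ y (π k)) w = φ y (π k) := ⟨y, hy, rfl⟩
    exact hsep k y hy _ (Function.invFunOn_mem hex) (Function.invFunOn_eq hex).symm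
  refine ⟨π, fun k v => Function.invFunOn (fun y => φ y (π k)) (latentSpace I) v k, ?_,
    fun y hy k => hinv k y hy⟩
  intro k
  refine ⟨?_, ?_, ?_⟩
  · rintro _ ⟨y, hy, rfl⟩
    dsimp only
    rw [← hinv k y hy]
    exact hy k trivial
  · rintro _ ⟨y, hy, rfl⟩ _ ⟨w, hw, rfl⟩ h
    dsimp only at h ⊢
    rw [← hinv k y hy, ← hinv k w hw] at h
    exact hdep k y hy w hw h
  · intro a ha
    have hv := hupd y₀ hy₀ k a ha
    exact ⟨_, ⟨_, hv, rfl⟩, by dsimp only; rw [← hinv k _ hv, Function.update_self]⟩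

/-! ### Log-density ratios along the diffeomorphism -/

/-- The densities are controlled only on `I k`; cutting them off outside makes them measurable on
`ℝ` without changing the measures. -/
lemma pi_restrict_withDensity_ofReal {n : ℕ} {I : Fin n → Set ℝ} (hI : ∀ k, IsOpen (I k))
    {f : Fin n → ℝ → ℝ} (hf : ∀ k, ContinuousOn (f k) (I k))
    [∀ k, IsProbabilityMeasure
      ((volume.restrict (I k)).withDensity fun a => ENNReal.ofReal (f k a))] :
    Measure.pi (fun k => (volume.restrict (I k)).withDensity fun a => ENNReal.ofReal (f k a)) =
      (volume.restrict (latentSpace I)).withDensity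
        (fun y => ∏ k, (I k).indicator (fun a => ENNReal.ofReal (f k a)) (y k)) ∧
    ∀ k, Measurable ((I k).indicator fun a => ENNReal.ofReal (f k a)) := by
  classical
  have hm : ∀ k, Measurable ((I k).indicator fun a => ENNReal.ofReal (f k a)) := by
    intro k
    rw [← Set.piecewise_eq_indicator]
    exact ContinuousOn.measurable_piecewise
      (ENNReal.continuous_ofReal.comp_continuousOn (hf k)) continuousOn_const
      (hI k).measurableSet
  have hk : ∀ k, (volume.restrict (I k)).withDensity (fun a => ENNReal.ofReal (f k a)) =
      (volume.restrict (I k)).withDensity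
        ((I k).indicator fun a => ENNReal.ofReal (f k a)) := by
    intro k
    refine withDensity_congr_ae ?_
    filter_upwards [ae_restrict_mem (hI k).measurableSet] with a ha
    rw [Set.indicator_of_mem ha]
  have : ∀ k, SigmaFinite ((volume.restrict (I k)).withDensity
      ((I k).indicator fun a => ENNReal.ofReal (f k a))) := fun k => by
    rw [← hk k]; infer_instance
  refine ⟨?_, hm⟩
  simp_rw [hk]
  rw [pi_withDensity_eq _ _ hm, ← Measure.restrict_pi_pi]
  rfl

/-- If a diffeomorphism sends two product measures with positive densities to product measures, the
log-ratio of the densities is a sum of functions of the components of the diffeomorphism. -/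
lemma exists_sum_log_sub_log_eq {n : ℕ} {I : Fin n → Set ℝ} (hI : ∀ k, IsOpen (I k))
    {φ : (Fin n → ℝ) → Fin n → ℝ} (hφ : Measurable φ) (hφc : ContinuousOn φ (latentSpace I))
    (hinj : Set.InjOn φ (latentSpace I)) {f f' : Fin n → ℝ → ℝ}
    (hf : ∀ k, ContinuousOn (f k) (I k)) (hf' : ∀ k, ContinuousOn (f' k) (I k))
    (hpos : ∀ k, ∀ a ∈ I k, 0 < f k a) (hpos' : ∀ k, ∀ a ∈ I k, 0 < f' k a)
    [∀ k, IsProbabilityMeasure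
      ((volume.restrict (I k)).withDensity fun a => ENNReal.ofReal (f k a))]
    [∀ k, IsProbabilityMeasure
      ((volume.restrict (I k)).withDensity fun a => ENNReal.ofReal (f' k a))]
    {ν ν' : Fin n → Measure ℝ} [∀ k, IsProbabilityMeasure (ν k)]
    [∀ k, IsProbabilityMeasure (ν' k)]
    (hν : (Measure.pi fun k => (volume.restrict (I k)).withDensity
      fun a => ENNReal.ofReal (f k a)).map φ = Measure.pi ν)
    (hν' : (Measure.pi fun k => (volume.restrict (I k)).withDensity
      fun a => ENNReal.ofReal (f' k a)).map φ = Measure.pi ν') :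
    ∃ c : Fin n → ℝ → ℝ, ∀ᵐ y, y ∈ latentSpace I →
      ∑ k, (Real.log (f k (y k)) - Real.log (f' k (y k))) = ∑ k, c k (φ y k) := by
  have hZ : MeasurableSet (latentSpace I) := (isOpen_latentSpace hI).measurableSet
  obtain ⟨hM, hm⟩ := pi_restrict_withDensity_ofReal hI hf
  obtain ⟨hM', hm'⟩ := pi_restrict_withDensity_ofReal hI hf'
  have hmp : ∀ h : Fin n → ℝ → ENNReal, (∀ k, Measurable (h k)) →
      Measurable fun y : Fin n → ℝ => ∏ k, h k (y k) := fun h hh =>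
    Finset.measurable_prod _ fun k _ => (hh k).comp (measurable_pi_apply k)
  have hval : ∀ (h : Fin n → ℝ → ℝ), ∀ y ∈ latentSpace I,
      ∏ k, (I k).indicator (fun a => ENNReal.ofReal (h k a)) (y k) =
        ∏ k, ENNReal.ofReal (h k (y k)) := fun h y hy =>
    Finset.prod_congr rfl fun k _ => Set.indicator_of_mem (hy k trivial) _
  have hnull : (volume.restrict (latentSpace I)) (latentSpace I)ᶜ = 0 := by
    rw [Measure.restrict_apply hZ.compl]; simp
  rw [hM] at hν
  rw [hM'] at hν'
  have hac' : volume.restrict (latentSpace I) ≪ (volume.restrict (latentSpace I)).withDensity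
      (fun y => ∏ k, (I k).indicator (fun a => ENNReal.ofReal (f' k a)) (y k)) := by
    refine withDensity_absolutelyContinuous' (hmp _ hm').aemeasurable ?_
    filter_upwards [ae_restrict_mem hZ] with y hy
    rw [hval f' y hy]
    exact Finset.prod_ne_zero_iff.2 fun k _ => by
      simpa using hpos' k (y k) (hy k trivial)
  obtain ⟨r, hr, hMr⟩ := exists_prod_density_of_map_eq_pi hZ hφ hφc hinj
    (withDensity_absolutelyContinuous _ _ hnull) (withDensity_absolutelyContinuous _ _ hnull)
    ((withDensity_absolutelyContinuous _ _).trans hac') hν hν'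
  have hrm : Measurable fun y => ∏ k, r k (φ y k) := (hmp r hr).comp hφ
  rw [← withDensity_mul _ (hmp _ hm') hrm] at hMr
  rw [withDensity_eq_iff_of_sigmaFinite (hmp _ hm).aemeasurable
    ((hmp _ hm').mul hrm).aemeasurable, Filter.EventuallyEq, ae_restrict_iff' hZ] at hMr
  refine ⟨fun k a => Real.log (r k a).toReal, ?_⟩
  filter_upwards [hMr] with y hy hyZ
  have h1 := hy hyZ
  rw [Pi.mul_apply, hval f y hyZ, hval f' y hyZ] at h1
  have h2 := congrArg ENNReal.toReal h1
  rw [ENNReal.toReal_mul, ENNReal.toReal_prod, ENNReal.toReal_prod, ENNReal.toReal_prod] at h2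
  have hp : ∀ k, 0 < f k (y k) := fun k => hpos k _ (hyZ k trivial)
  have hp' : ∀ k, 0 < f' k (y k) := fun k => hpos' k _ (hyZ k trivial)
  simp_rw [ENNReal.toReal_ofReal (hp _).le, ENNReal.toReal_ofReal (hp' _).le] at h2
  have h3 : ∏ k, f k (y k) ≠ 0 := Finset.prod_ne_zero_iff.2 fun k _ => (hp k).ne'
  have h4 : ∏ k, f' k (y k) ≠ 0 := Finset.prod_ne_zero_iff.2 fun k _ => (hp' k).ne'
  -- Positivity of the first density excludes both values `0` and `∞` of `r k`, since `toReal` sends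
  -- each to `0`.
  have h5 : ∏ k, (r k (φ y k)).toReal ≠ 0 := fun h => h3 (by rw [h2, h, mul_zero])
  rw [Finset.sum_sub_distrib, ← Real.log_prod fun k _ => (hp k).ne',
    ← Real.log_prod fun k _ => (hp' k).ne', h2, Real.log_mul h4 h5,
    Real.log_prod fun k hk => Finset.prod_ne_zero_iff.1 h5 k hk]
  ring

/-! ### Conditional laws of the latent vector and of its image -/

lemma condIndepComponents_congr_comap {Ω : Type*} [MeasurableSpace Ω] [StandardBorelSpace Ω]
    {P : Measure Ω} [IsFiniteMeasure P] {n : ℕ} {Y S S' : Ω → Fin n → ℝ} {hS : Measurable S}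
    (hS' : Measurable S')
    (h : MeasurableSpace.comap S inferInstance = MeasurableSpace.comap S' inferInstance)
    (hY : CondIndepComponents P Y S hS) : CondIndepComponents P Y S' hS' := by
  have aux : ∀ (m m' : MeasurableSpace Ω) (hm : m ≤ _) (hm' : m' ≤ _), m = m' →
      iCondIndepFun m hm (fun k ω => Y ω k) P → iCondIndepFun m' hm' (fun k ω => Y ω k) P := by
    rintro m _ hm hm' rfl h
    exact h
  exact aux _ _ hS.comap_le hS'.comap_le h hY

lemma ae_condDistrib_eq_pi_density {Ω : Type*} [MeasurableSpace Ω] [StandardBorelSpace Ω]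
    (P : Measure Ω) [IsProbabilityMeasure P] {n : ℕ} {I : Fin n → Set ℝ}
    {Y S : Ω → Fin n → ℝ} (hY : Measurable Y) (hS : Measurable S)
    (hci : CondIndepComponents P Y S hS) {p : Fin n → ℝ → (Fin n → ℝ) → ℝ}
    (hp : ∀ k, IsCondDensityOn P (fun ω => Y ω k) S (I k) (p k)) :
    ∀ᵐ s ∂(P.map S),
      (∀ k, IsProbabilityMeasure
        ((volume.restrict (I k)).withDensity fun a => ENNReal.ofReal (p k a s))) ∧
      condDistrib Y S P s = Measure.pi fun k =>
        (volume.restrict (I k)).withDensity fun a => ENNReal.ofReal (p k a s) := by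
  have h1 := condDistrib_eq_pi_of_condIndepComponents P hY hS hci
  have h2 : ∀ k, condDistrib (fun ω => Y ω k) S P =ᵐ[P.map S]
      (condDistrib Y S P).map (fun y => y k) := fun k =>
    condDistrib_comp S hY.aemeasurable (measurable_pi_apply k)
  filter_upwards [h1, ae_all_iff.2 h2, ae_all_iff.2 hp] with s a1 a2 a3
  have hk : ∀ k, (condDistrib Y S P s).map (fun y => y k) =
      (volume.restrict (I k)).withDensity fun a => ENNReal.ofReal (p k a s) := fun k => by
    rw [← a3 k, a2 k, Kernel.map_apply _ (measurable_pi_apply k)]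
  refine ⟨fun k => ?_, ?_⟩
  · rw [← a3 k]; infer_instance
  · simp_rw [← hk]
    exact a1

lemma ae_exists_map_pi_density_eq_pi {Ω : Type*} [MeasurableSpace Ω] [StandardBorelSpace Ω]
    (P : Measure Ω) [IsProbabilityMeasure P] {n : ℕ} {I : Fin n → Set ℝ}
    (hI : ∀ k, IsOpen (I k)) {φ : (Fin n → ℝ) → Fin n → ℝ} (hφ : Measurable φ)
    (hφc : ContinuousOn φ (latentSpace I)) (hinj : Set.InjOn φ (latentSpace I))
    {Y S : Ω → Fin n → ℝ} (hY : Measurable Y) (hS : Measurable S)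
    (hSI : ∀ ω, S ω ∈ latentSpace I)
    (hci : CondIndepComponents P Y S hS)
    (hciφ : CondIndepComponents P (φ ∘ Y) (φ ∘ S) (hφ.comp hS))
    {p : Fin n → ℝ → (Fin n → ℝ) → ℝ}
    (hp : ∀ k, IsCondDensityOn P (fun ω => Y ω k) S (I k) (p k)) :
    ∀ᵐ s ∂(P.map S),
      (∀ k, IsProbabilityMeasure
        ((volume.restrict (I k)).withDensity fun a => ENNReal.ofReal (p k a s))) ∧
      ∃ ν : Fin n → Measure ℝ, (∀ k, IsProbabilityMeasure (ν k)) ∧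
        (Measure.pi fun k => (volume.restrict (I k)).withDensity
          fun a => ENNReal.ofReal (p k a s)).map φ = Measure.pi ν := by
  have h1 := ae_condDistrib_eq_pi_density P hY hS hci hp
  have h2 := condDistrib_eq_pi_of_condIndepComponents P (hφ.comp hY) hS
    (condIndepComponents_congr_comap hS (comap_comp_eq_of_injOn
      (isOpen_latentSpace hI).measurableSet hφ hφc hinj hSI) hciφ)
  have h3 := condDistrib_comp (μ := P) (mβ := MeasurableSpace.pi) S hY.aemeasurable hφ
  filter_upwards [h1, h2, h3] with s a1 a2 a3
  refine ⟨a1.1, fun k => (condDistrib (φ ∘ Y) S P s).map (fun y => y k), fun k => Measure.isProbabilityMeasure_map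
    (measurable_pi_apply k).aemeasurable, ?_⟩
  rw [← a2, a3, Kernel.map_apply _ hφ, a1.2]

/-! ### Log-density derivatives and linear independence -/

lemma hasDerivAt_logDensity {n : ℕ} {p : ℝ → (Fin n → ℝ) → ℝ} {J : Set ℝ}
    {U : Set (Fin n → ℝ)} (h : RegularLogDensity p J U) {s : Fin n → ℝ} (hs : s ∈ U) {y : ℝ}
    (hy : y ∈ J) : HasDerivAt (fun a => logDensity p a s) (dLogDensity p y s) y :=
  (h.diff_one s hs y hy).hasDerivAt

lemma hasDerivAt_dLogDensity {n : ℕ} {p : ℝ → (Fin n → ℝ) → ℝ} {J : Set ℝ}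
    {U : Set (Fin n → ℝ)} (h : RegularLogDensity p J U) {s : Fin n → ℝ} (hs : s ∈ U) {y : ℝ}
    (hy : y ∈ J) : HasDerivAt (fun a => dLogDensity p a s) (ddLogDensity p y s) y :=
  (h.diff_two s hs y hy).hasDerivAt

lemma continuousOn_density {n : ℕ} {p : ℝ → (Fin n → ℝ) → ℝ} {J : Set ℝ}
    {U : Set (Fin n → ℝ)} (h : RegularLogDensity p J U) {s : Fin n → ℝ} (hs : s ∈ U)
    (hpos : ∀ y ∈ J, 0 < p y s) : ContinuousOn (fun y => p y s) J := by
  have h1 : ContinuousOn (fun y => Real.exp (logDensity p y s)) J :=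
    Real.continuous_exp.comp_continuousOn fun y hy =>
      (h.diff_one s hs y hy).continuousAt.continuousWithinAt
  exact h1.congr fun y hy => (Real.exp_log (hpos y hy)).symm

/-- Under the linear independence condition, coefficients for which the combination of second and
first log-density derivatives does not depend on the conditioning value must vanish. -/
lemma coeff_eq_zero_of_linIndepCondition {n : ℕ} {I : Fin n → Set ℝ} (hI : ∀ k, IsOpen (I k))
    {p : Fin n → ℝ → (Fin n → ℝ) → ℝ}
    (hreg : ∀ k, RegularLogDensity (p k) (I k) (latentSpace I))
    (hli : LinIndepCondition p (latentSpace I)) {y : Fin n → ℝ} (hy : y ∈ latentSpace I)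
    (a b : Fin n → ℝ) (C : ℝ)
    (h : ∀ᵐ s, s ∈ latentSpace I →
      ∑ k, (ddLogDensity (p k) (y k) s * a k + dLogDensity (p k) (y k) s * b k) = C) :
    ∀ k, a k = 0 := by
  have hder : ∀ s ∈ latentSpace I, ∀ l, HasDerivAt
      (fun r => ∑ k, (ddLogDensity (p k) (y k) (Function.update s l r) * a k +
        dLogDensity (p k) (y k) (Function.update s l r) * b k))
      (∑ k, (vRingVec (p k) (y k) s l * a k + vVec (p k) (y k) s l * b k)) (s l) := by
    intro s hs l
    refine HasDerivAt.fun_sum fun k _ => ?_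
    have h1 := ((hreg k).diff_mixed_one s hs (y k) (hy k trivial) l).hasDerivAt
    have h2 := ((hreg k).diff_mixed_two s hs (y k) (hy k trivial) l).hasDerivAt
    exact (h2.mul_const (a k)).add (h1.mul_const (b k))
  have hconst := eq_of_ae_eq_of_separately_continuousAt I hI
    (fun s => ∑ k, (ddLogDensity (p k) (y k) s * a k + dLogDensity (p k) (y k) s * b k)) C
    (fun s hs l => (hder s hs l).continuousAt) h
  have hzero : ∀ s ∈ latentSpace I, ∀ l,
      ∑ k, (vRingVec (p k) (y k) s l * a k + vVec (p k) (y k) s l * b k) = 0 := by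
    intro s hs l
    refine (hder s hs l).unique ((hasDerivAt_const (s l) C).congr_of_eventuallyEq ?_)
    have hcont : Continuous fun r : ℝ => Function.update s l r :=
      continuous_const.update l continuous_id
    filter_upwards [hcont.continuousAt.eventually_mem ((isOpen_latentSpace hI).mem_nhds
      (show Function.update s l (s l) ∈ latentSpace I by rwa [Function.update_eq_self]))]
      with r hr using hconst _ hr
  -- The vectors `v` carry the coefficients `b`, and `v̊` the coefficients `a`.
  have := Fintype.linearIndependent_iff.1 (hli y hy) (Sum.elim b a) ?_
  · exact fun k => this (Sum.inr k)
  · funext s l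
    have := hzero s s.2 l
    rw [Finset.sum_add_distrib] at this
    simp only [Fintype.sum_sum_type, Sum.elim_inl, Sum.elim_inr, Finset.sum_apply,
      Pi.smul_apply, smul_eq_mul, Pi.zero_apply]
    rw [add_comm, ← this]
    simp only [mul_comm]

/-! ### The inverse map and the identifiability theorem -/

/-- An injective regular `C²` map on an open set is a homeomorphism onto an open set with `C²`
inverse. -/
lemma exists_openPartialHomeomorph_of_isRegularC2On {n : ℕ} {φ : (Fin n → ℝ) → Fin n → ℝ}
    {U : Set (Fin n → ℝ)} (hU : IsOpen U) (h : IsRegularC2On φ U) (hinj : Set.InjOn φ U) :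
    ∃ e : OpenPartialHomeomorph (Fin n → ℝ) (Fin n → ℝ), ⇑e = φ ∧ e.source = U ∧
      ∀ u ∈ e.target, ContDiffAt ℝ 2 e.symm u := by
  have hat : ∀ y ∈ U, ContDiffAt ℝ 2 φ y := fun y hy => h.1.contDiffAt (hU.mem_nhds hy)
  have hequiv : ∀ y ∈ U, ∃ L : (Fin n → ℝ) ≃L[ℝ] (Fin n → ℝ),
      (L : (Fin n → ℝ) →L[ℝ] (Fin n → ℝ)) = fderiv ℝ φ y := fun y hy =>
    ⟨(fderiv ℝ φ y).toContinuousLinearEquivOfDetNeZero (h.2 y hy),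
      ContinuousLinearMap.coe_toContinuousLinearEquivOfDetNeZero _ _⟩
  have hopen : IsOpenMap (U.domRestrict φ) := by
    rw [isOpenMap_iff_nhds_le]
    rintro ⟨y, hy⟩
    obtain ⟨L, hL⟩ := hequiv y hy
    have hs : HasStrictFDerivAt φ (L : (Fin n → ℝ) →L[ℝ] (Fin n → ℝ)) y := by
      rw [hL]; exact (hat y hy).hasStrictFDerivAt two_ne_zero
    have := hs.map_nhds_eq_of_equiv
    rw [Set.domRestrict_eq, ← Filter.map_map, map_nhds_subtype_coe_eq_nhds hy (hU.mem_nhds hy)]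
    exact this.ge
  refine ⟨OpenPartialHomeomorph.ofContinuousOpenRestrict (hinj.toPartialEquiv φ U)
    h.1.continuousOn hopen hU, rfl, rfl, fun u hu => ?_⟩
  have hy := OpenPartialHomeomorph.map_target _ hu
  obtain ⟨L, hL⟩ := hequiv _ hy
  refine OpenPartialHomeomorph.contDiffAt_symm _ hu (f₀' := L) ?_ (hat _ hy)
  rw [hL]
  exact ((hat _ hy).differentiableAt two_ne_zero).hasFDerivAt

lemma exists_injective_support_fderiv {Ω : Type*} [MeasurableSpace Ω] [StandardBorelSpace Ω]
    (P : Measure Ω) [IsProbabilityMeasure P] {n : ℕ} {I : Fin n → Set ℝ}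
    (hI : ∀ k, IsOpen (I k)) {φ : (Fin n → ℝ) → Fin n → ℝ} (hφ : Measurable φ)
    (hinj : Set.InjOn φ (latentSpace I)) (hsmooth : IsRegularC2On φ (latentSpace I))
    {Y S : Ω → Fin n → ℝ} (hY : Measurable Y) (hS : Measurable S)
    (hSI : ∀ ω, S ω ∈ latentSpace I)
    (hprev : volume.restrict (latentSpace I) ≪ P.map S)
    (hci : CondIndepComponents P Y S hS)
    (hciφ : CondIndepComponents P (φ ∘ Y) (φ ∘ S) (hφ.comp hS))
    {p : Fin n → ℝ → (Fin n → ℝ) → ℝ}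
    (hp : ∀ k, IsCondDensityOn P (fun ω => Y ω k) S (I k) (p k))
    (hp_pos : ∀ k, ∀ y ∈ I k, ∀ s ∈ latentSpace I, 0 < p k y s)
    (hp_reg : ∀ k, RegularLogDensity (p k) (I k) (latentSpace I))
    (hli : LinIndepCondition p (latentSpace I)) {y : Fin n → ℝ} (hy : y ∈ latentSpace I) :
    ∃ σ : Fin n → Fin n, Function.Injective σ ∧
      ∀ k l, fderiv ℝ φ y (Pi.single l 1) (σ k) ≠ 0 ↔ l = k := by
  have hZo := isOpen_latentSpace hI
  have hφc := hsmooth.1.continuousOn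
  have hφd : ∀ w ∈ latentSpace I, DifferentiableAt ℝ φ w := fun w hw =>
    (hsmooth.1.contDiffAt (hZo.mem_nhds hw)).differentiableAt two_ne_zero
  obtain ⟨e, he, hsource, hsymm⟩ := exists_openPartialHomeomorph_of_isRegularC2On hZo hsmooth hinj
  have hmem : ∀ u ∈ e.target, e.symm u ∈ latentSpace I := fun u hu =>
    hsource ▸ e.map_target hu
  have hyt : φ y ∈ e.target := by
    rw [← he]; exact e.map_source (by rwa [hsource])
  have hey : e.symm (φ y) = y := by
    rw [← he]; exact e.left_inv (by rwa [hsource])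
  have hgood := (ae_restrict_iff' hZo.measurableSet).1 (hprev.ae_le
    (ae_exists_map_pi_density_eq_pi P hI hφ hφc hinj hY hS hSI hci hciφ hp))
  refine exists_injective_support_of_leftInverse (J := fderiv ℝ e.symm (φ y)) ?_ ?_
  · intro v
    have h1 : HasFDerivAt (e.symm ∘ φ) ((fderiv ℝ e.symm (φ y)).comp (fderiv ℝ φ y)) y :=
      (((hsymm _ hyt).differentiableAt two_ne_zero).hasFDerivAt).comp y (hφd y hy).hasFDerivAt
    have h2 : HasFDerivAt (e.symm ∘ φ) (ContinuousLinearMap.id ℝ (Fin n → ℝ)) y := by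
      refine (hasFDerivAt_id y).congr_of_eventuallyEq ?_
      filter_upwards [hZo.mem_nhds hy] with w hw
      rw [Function.comp_apply, ← he]
      exact e.left_inv (by rwa [hsource])
    exact DFunLike.congr_fun (h1.unique h2) v
  · intro k i j hij
    have hpos : volume (latentSpace I) ≠ 0 := (hZo.measure_pos volume ⟨y, hy⟩).ne'
    -- The good conditioning values have full measure in a box of positive volume, so one can serve
    -- as reference.
    obtain ⟨s₀, hs₀, hs₀'⟩ := ((frequently_ae_mem_iff.2 hpos).and_eventually hgood).exists
    obtain ⟨hprob₀, ν₀, hν₀, hmap₀⟩ := hs₀' hs₀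
    refine coeff_eq_zero_of_linIndepCondition hI hp_reg hli hy
      (fun k => fderiv ℝ e.symm (φ y) (Pi.single j 1) k *
        fderiv ℝ e.symm (φ y) (Pi.single i 1) k)
      (fun k => deriv (fun b : ℝ =>
        fderiv ℝ e.symm (φ y + Pi.single j b) (Pi.single i 1) k) 0)
      (∑ k, (ddLogDensity (p k) (y k) s₀ * (fderiv ℝ e.symm (φ y) (Pi.single j 1) k *
        fderiv ℝ e.symm (φ y) (Pi.single i 1) k) + dLogDensity (p k) (y k) s₀ *
        deriv (fun b : ℝ =>
          fderiv ℝ e.symm (φ y + Pi.single j b) (Pi.single i 1) k) 0)) ?_ k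
    filter_upwards [hgood] with s hs' hs
    obtain ⟨hprob, ν, hν, hmap⟩ := hs' hs
    obtain ⟨c, hc⟩ := exists_sum_log_sub_log_eq hI hφ hφc hinj
      (f := fun k a => p k a s) (f' := fun k a => p k a s₀)
      (fun k => continuousOn_density (hp_reg k) hs fun a ha => hp_pos k a ha s hs)
      (fun k => continuousOn_density (hp_reg k) hs₀ fun a ha => hp_pos k a ha s₀ hs₀)
      (fun k a ha => hp_pos k a ha s hs) (fun k a ha => hp_pos k a ha s₀ hs₀) hmap hmap₀
    -- The identity fails only on a null subset of the box. Differentiable maps preserve null sets,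
    -- so it holds for almost every `u` in the target.
    have hnull := addHaar_image_eq_zero_of_differentiableOn_of_addHaar_eq_zero volume
      (f := φ) (fun w hw => (hφd w (by
        by_contra h
        exact hw fun hw' => absurd hw' h)).differentiableWithinAt) hc
    have hcu : ∀ᵐ u, u ∈ e.target →
        ∑ k, (logDensity (p k) (e.symm u k) s - logDensity (p k) (e.symm u k) s₀) =
          ∑ k, c k (u k) := by
      filter_upwards [measure_eq_zero_iff_ae_notMem.1 hnull] with u hu hut
      by_contra hcontra
      have hu' : φ (e.symm u) = u := by rw [← he]; exact e.right_inv hut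
      refine hu ⟨e.symm u, fun hcon => hcontra ?_, hu'⟩
      have := hcon (hmem u hut)
      rw [hu'] at this
      exact this
    have hmix := sum_mixed_deriv_comp_eq_zero (I := I) e.open_target hsymm hmem
      (δ := fun k a => logDensity (p k) a s - logDensity (p k) a s₀)
      (δ' := fun k a => dLogDensity (p k) a s - dLogDensity (p k) a s₀)
      (δ'' := fun k a => ddLogDensity (p k) a s - ddLogDensity (p k) a s₀)
      (fun k a ha => (hasDerivAt_logDensity (hp_reg k) hs ha).sub
        (hasDerivAt_logDensity (hp_reg k) hs₀ ha))
      (fun k a ha => (hasDerivAt_dLogDensity (hp_reg k) hs ha).sub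
        (hasDerivAt_dLogDensity (hp_reg k) hs₀ ha)) c hcu hij hyt
    rw [hey] at hmix
    rw [← sub_eq_zero, ← Finset.sum_sub_distrib]
    refine Eq.trans ?_ hmix
    exact Finset.sum_congr rfl fun k _ => by ring

theorem theorem1 {Ω : Type*} [MeasurableSpace Ω] [StandardBorelSpace Ω]
    (P : Measure Ω) [IsProbabilityMeasure P] {X : Type*} (n : ℕ)
    -- the latent process, with values in a product of open intervals
    (I : Fin n → Set ℝ) (hI_open : ∀ k, IsOpen (I k)) (hI_conn : ∀ k, (I k).OrdConnected)
    (z : ℤ → Ω → Fin n → ℝ) (hz : ∀ τ, Measurable (z τ)) (hzI : ∀ τ ω, z τ ω ∈ latentSpace I)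
    -- the observations
    (g : (Fin n → ℝ) → X) (hg : Set.InjOn g (latentSpace I))
    (x : ℤ → Ω → X) (hx : ∀ τ ω, x τ ω = g (z τ ω))
    -- the estimator
    (ghat : X → Fin n → ℝ) (hghat : Set.InjOn ghat (g '' latentSpace I))
    (zhat : ℤ → Ω → Fin n → ℝ) (hzhat : ∀ τ ω, zhat τ ω = ghat (x τ ω))
    (hzhat_meas : ∀ τ, Measurable (zhat τ))
    (hsmooth : IsRegularC2On (ghat ∘ g) (latentSpace I))
    -- the time, and the law of the latent vector at the previous time
    (t : ℤ) (hprev : volume.restrict (latentSpace I) ≪ P.map (z (t - 1)))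
    -- conditional independence of the true and of the estimated components
    (hci : CondIndepComponents P (z t) (z (t - 1)) (hz (t - 1)))
    (hcihat : CondIndepComponents P (zhat t) (zhat (t - 1)) (hzhat_meas (t - 1)))
    -- the conditional densities of the components
    (p : Fin n → ℝ → (Fin n → ℝ) → ℝ)
    (hp : ∀ k, IsCondDensityOn P (fun ω => z t ω k) (z (t - 1)) (I k) (p k))
    (hp_pos : ∀ k, ∀ y ∈ I k, ∀ s ∈ latentSpace I, 0 < p k y s)
    (hp_reg : ∀ k, RegularLogDensity (p k) (I k) (latentSpace I))
    (hli : LinIndepCondition p (latentSpace I)) :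
    ∃ (π : Equiv.Perm (Fin n)) (T : Fin n → ℝ → ℝ),
      (∀ k, Set.BijOn (T k) ((fun y => ghat (g y) (π k)) '' latentSpace I) (I k)) ∧
      (∀ y ∈ latentSpace I, ∀ k, y k = T k (ghat (g y) (π k))) ∧
      (∀ τ ω k, z τ ω k = T k (zhat τ ω (π k))) := by
  classical
  obtain ⟨ω₀⟩ : Nonempty Ω := P.nonempty_of_neZero
  have hZo := isOpen_latentSpace hI_open
  have hinj : Set.InjOn (ghat ∘ g) (latentSpace I) :=
    hghat.comp hg (Set.mapsTo_image g _)
  -- Outside the box `ghat ∘ g` is arbitrary and may fail to be measurable; the value `0` there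
  -- repairs this, leaving the process and the derivatives on the open box unchanged.
  have hφeq : Set.EqOn ((latentSpace I).piecewise (ghat ∘ g) fun _ => 0) (ghat ∘ g)
      (latentSpace I) := Set.piecewise_eqOn _ _ _
  have hφ : Measurable ((latentSpace I).piecewise (ghat ∘ g) fun _ => 0) :=
    hsmooth.1.continuousOn.measurable_piecewise continuousOn_const hZo.measurableSet
  have hfd : ∀ y ∈ latentSpace I,
      fderiv ℝ ((latentSpace I).piecewise (ghat ∘ g) fun _ => 0) y = fderiv ℝ (ghat ∘ g) y :=
    fun y hy => (hφeq.eventuallyEq_of_mem (hZo.mem_nhds hy)).fderiv_eq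
  have hzφ : ∀ τ, zhat τ = ((latentSpace I).piecewise (ghat ∘ g) fun _ => 0) ∘ z τ := by
    intro τ
    funext ω
    rw [hzhat, hx, Function.comp_apply, hφeq (hzI τ ω), Function.comp_apply]
  have hciφ : CondIndepComponents P
      (((latentSpace I).piecewise (ghat ∘ g) fun _ => 0) ∘ z t)
      (((latentSpace I).piecewise (ghat ∘ g) fun _ => 0) ∘ z (t - 1))
      (hφ.comp (hz (t - 1))) := by
    have aux : ∀ (A B A' B' : Ω → Fin n → ℝ) (hB : Measurable B) (hB' : Measurable B'),
        A = A' → B = B' → CondIndepComponents P A B hB → CondIndepComponents P A' B' hB' := by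
      rintro A B _ _ hB hB' rfl rfl h
      exact h
    exact aux _ _ _ _ _ _ (hzφ t) (hzφ (t - 1)) hcihat
  obtain ⟨π, T, hT, hT'⟩ := exists_perm_componentwise_inverse hI_conn ⟨z t ω₀, hzI t ω₀⟩
    (φ := ghat ∘ g)
    (fun y hy => (hsmooth.1.contDiffAt (hZo.mem_nhds hy)).differentiableAt two_ne_zero)
    (hsmooth.1.continuousOn_fderiv_of_isOpen hZo one_le_two) hinj
    (fun y hy => by
      rw [← hfd y hy]
      exact exists_injective_support_fderiv P hI_open hφ (hinj.congr hφeq.symm)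
        ⟨hsmooth.1.congr hφeq, fun w hw => by rw [hfd w hw]; exact hsmooth.2 w hw⟩
        (hz t) (hz (t - 1)) (hzI (t - 1)) hprev hci hciφ hp hp_pos hp_reg hli hy)
  refine ⟨π, T, hT, hT', fun τ ω k => ?_⟩
  rw [hzhat, hx]
  exact hT' _ (hzI τ ω) k
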